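/- **Setting.** Let $Q$ be a smooth (Hausdorff) manifold of dimension $n$, $\mathcal D\subset TQ$ a smooth distribution of rank $k$ (not necessarily bracket generating) and $g$ a smooth positive definite symmetric bilinear form on $\mathcal D$. A curve $\gamma:[a,b]\to Q$ is *ACB* if in local coordinates it is absolutely continuous with essentially bounded derivative; it is *admissible* if it is ACB and $\dot\gamma(t)\in\mathcal D_{\gamma(t)}$ for almost every $t$. Its energy is $\mathcal E(\gamma)=\frac12\int_a^b g(\dot\gamma(t),\dot\gamma(t))\,dt$. An admissible curve $\gamma:[a,b]\to Q$ is a *minimizing sub-Riemannian geodesic* if $\mathcal E(\gamma)\le\mathcal E(\eta)$ for every admissible $\eta:[a,b]\to Q$ with $\eta(a)=\gamma(a)$ and $\eta(b)=\gamma(b)$. An admissible curve $\gamma:[0,T]\to Q$, $T>0$, is a *normal sub-Riemannian extremal* if it satisfies the Pontryagin maximum principle with normal multiplier, i.e. if there are covectors $p(t)\in T^*_{\gamma(t)}Q$, $t\in[0,T]$, such that around each time, in local coordinates and for some smooth local $g$-orthonormal frame $X_1,\dots,X_k$ of $\mathcal D$, there is a bounded measurable control $u$ for which $p$ is ACB and,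 for almost every $t$, $$\dot\gamma(t)=\sum_i u^i(t)X_i(\gamma(t)),\qquad \dot p(t)=-\sum_i u^i(t)\,p(t)\circ DX_i(\gamma(t)),$$ $$\langle p(t),\textstyle\sum_i u^i(t)X_i(\gamma(t))\rangle-\tfrac12\sum_i u^i(t)^2=\max_{w\in\mathbb R^k}\Big(\langle p(t),\textstyle\sum_i w^iX_i(\gamma(t))\rangle-\tfrac12\sum_i (w^i)^2\Big).$$ **Theorem (Local optimality of normal sub-Riemannian extremals).** Let $\gamma:[0,T]\to Q$ be a normal sub-Riemannian extremal. Then there exists $\varepsilon>0$ such that for every interval $[a,b]\subset[0,T]$ of length smaller than $\varepsilon$ the restriction $\gamma|_{[a,b]}$ is a minimizing sub-Riemannian geodesic. Moreover, $\gamma|_{[a,b]}$ is the unique minimizing sub-Riemannian geodesic $[a,b]\to Q$ joining its end-points. -/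

import Mathlib

open Set MeasureTheory
open scoped Manifold ContDiff

noncomputable section

/-- A curve in a normed space is *ACB* on `[a, b]` if it is absolutely continuous there and its
(almost everywhere defined) derivative is essentially bounded. -/
def IsACB {E : Type*} [NormedAddCommGroup E] [NormedSpace ℝ E] (x : ℝ → E) (a b : ℝ) : Prop :=
  AbsolutelyContinuousOnInterval x a b ∧
    ∃ C : ℝ, ∀ᵐ t ∂(volume.restrict (Icc a b)), ‖deriv x t‖ ≤ C

section Manifold

variable {n : ℕ} {Q : Type*} [TopologicalSpace Q] [ChartedSpace (EuclideanSpace ℝ (Fin n)) Q]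

/-- A curve in a manifold is ACB on `[a, b]` if it is continuous there and all its coordinate
representations, on the subintervals that it maps into a chart domain, are ACB. -/
def IsACBCurve (n : ℕ) {Q : Type*} [TopologicalSpace Q]
    [ChartedSpace (EuclideanSpace ℝ (Fin n)) Q] (γ : ℝ → Q) (a b : ℝ) : Prop :=
  ContinuousOn γ (Icc a b) ∧
    ∀ (q₀ : Q) (c d : ℝ), a ≤ c → c ≤ d → d ≤ b →
      MapsTo γ (Icc c d) (extChartAt (𝓡 n) q₀).source →
      IsACB (fun t => extChartAt (𝓡 n) q₀ (γ t)) c d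

/-- The velocity vector of a curve in a manifold. -/
def velocity (n : ℕ) {Q : Type*} [TopologicalSpace Q]
    [ChartedSpace (EuclideanSpace ℝ (Fin n)) Q] (γ : ℝ → Q) (t : ℝ) :
    TangentSpace (𝓡 n) (γ t) :=
  mfderiv 𝓘(ℝ, ℝ) (𝓡 n) γ t (1 : ℝ)

/-- The coordinate representation, in the preferred chart at `q₀`, of a vector field `X`. It is
meaningful on the target of that chart. -/
def coordField (q₀ : Q) (X : ∀ q : Q, TangentSpace (𝓡 n) q) (x : EuclideanSpace ℝ (Fin n)) :
    EuclideanSpace ℝ (Fin n) :=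
  mfderiv (𝓡 n) 𝓘(ℝ, EuclideanSpace ℝ (Fin n)) (extChartAt (𝓡 n) q₀)
    ((extChartAt (𝓡 n) q₀).symm x) (X ((extChartAt (𝓡 n) q₀).symm x))

/-- A section of a family of subspaces of the tangent spaces is smooth on `U` if it is smooth on
`U` as a vector field. -/
def IsSmoothSection (D : ∀ q : Q, Submodule ℝ (TangentSpace (𝓡 n) q)) (X : ∀ q : Q, D q)
    (U : Set Q) [IsManifold (𝓡 n) ∞ Q] : Prop :=
  ContMDiffOn (𝓡 n) (𝓡 n).tangent ∞
    (fun q => (⟨q, (X q : TangentSpace (𝓡 n) q)⟩ : TangentBundle (𝓡 n) Q)) U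

end Manifold

/-- A sub-Riemannian structure on a smooth `n`-dimensional manifold `Q`: a smooth distribution
`D` of rank `k` with a smooth positive definite symmetric bilinear form `g` on it. The
distribution is not required to be bracket generating. -/
structure SubRiemannianStructure (n k : ℕ) (Q : Type*) [TopologicalSpace Q]
    [ChartedSpace (EuclideanSpace ℝ (Fin n)) Q] [IsManifold (𝓡 n) ∞ Q] where
  /-- the distribution -/
  D : ∀ q : Q, Submodule ℝ (TangentSpace (𝓡 n) q)
  /-- around each point the distribution is spanned by `k` independent smooth sections -/
  exists_frame : ∀ q₀ : Q, ∃ U : Set Q, IsOpen U ∧ q₀ ∈ U ∧ ∃ X : Fin k → ∀ q : Q, D q,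
    (∀ i, IsSmoothSection D (X i) U) ∧
    ∀ q ∈ U, LinearIndependent ℝ (fun i => X i q) ∧ Submodule.span ℝ (range fun i => X i q) = ⊤
  /-- the sub-Riemannian metric -/
  g : ∀ q : Q, D q →ₗ[ℝ] D q →ₗ[ℝ] ℝ
  g_symm : ∀ (q : Q) (v w : D q), g q v w = g q w v
  g_pos : ∀ (q : Q) (v : D q), v ≠ 0 → 0 < g q v v
  /-- the metric is smooth: its values on smooth local sections are smooth -/
  g_smooth : ∀ (U : Set Q) (X Y : ∀ q : Q, D q), IsOpen U →
    IsSmoothSection D X U → IsSmoothSection D Y U →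
    ContMDiffOn (𝓡 n) 𝓘(ℝ, ℝ) ∞ (fun q => g q (X q) (Y q)) U

namespace SubRiemannianStructure

variable {n k : ℕ} {Q : Type*} [TopologicalSpace Q] [ChartedSpace (EuclideanSpace ℝ (Fin n)) Q]
  [IsManifold (𝓡 n) ∞ Q] (S : SubRiemannianStructure n k Q)

/-- An ACB curve on `[a, b]` that is almost everywhere tangent to the distribution. -/
def IsAdmissible (γ : ℝ → Q) (a b : ℝ) : Prop :=
  IsACBCurve n γ a b ∧ ∀ᵐ t ∂(volume.restrict (Icc a b)), velocity n γ t ∈ S.D (γ t)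

open Classical in
/-- The value `g (v, v)` for a vector `v` of the distribution (and `0` for other vectors; an
admissible curve meets those on a null set of times only). -/
def quad (q : Q) (v : TangentSpace (𝓡 n) q) : ℝ :=
  if h : v ∈ S.D q then S.g q ⟨v, h⟩ ⟨v, h⟩ else 0

/-- The energy of a curve on `[a, b]`. -/
def energy (γ : ℝ → Q) (a b : ℝ) : ℝ :=
  (1 / 2) * ∫ t in a..b, S.quad (γ t) (velocity n γ t)

/-- A minimizing sub-Riemannian geodesic on `[a, b]`: an admissible curve whose energy is minimal
among all admissible curves on `[a, b]` with the same end-points. -/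
def IsMinimizingGeodesic (γ : ℝ → Q) (a b : ℝ) : Prop :=
  S.IsAdmissible γ a b ∧
    ∀ η : ℝ → Q, S.IsAdmissible η a b → η a = γ a → η b = γ b →
      S.energy γ a b ≤ S.energy η a b

/-- A smooth `g`-orthonormal frame of the distribution on the open set `U`. -/
def IsOrthonormalFrame (U : Set Q) (X : Fin k → ∀ q : Q, S.D q) : Prop :=
  IsOpen U ∧ (∀ i, IsSmoothSection S.D (X i) U) ∧
    ∀ q ∈ U, (∀ i j, S.g q (X i q) (X j q) = if i = j then 1 else 0) ∧
      Submodule.span ℝ (range fun i => X i q) = ⊤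

/-- The vector `∑ i, w i • X i q` of the control system given by the frame `X`. -/
def controlVec (X : Fin k → ∀ q : Q, S.D q) (q : Q) (w : Fin k → ℝ) : TangentSpace (𝓡 n) q :=
  ∑ i, w i • (X i q : TangentSpace (𝓡 n) q)

/-- The conditions of the Pontryagin maximum principle with normal multiplier, on `[c, d]`, for
the curve `γ` and the covector field `p` along it, in the preferred chart at `q₀` and for the
control system `q' = ∑ i, u i • X i q` with running cost `(1 / 2) * ∑ i, u i ^ 2`, where `X` is an
orthonormal frame on `U`. Here `u` is the control of `γ` and `ξ` is the coordinate
representation of `p`; the last three conditions say that `γ` is the trajectory of `u`, that `ξ`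
solves the adjoint equation `ξ' = - ∑ i, u i • ⟨ξ, d (X i)⟩`, and that `u t` maximizes the
Hamiltonian `w ↦ ⟨p t, ∑ i, w i • X i⟩ - (1 / 2) * ∑ i, w i ^ 2`. -/
def IsNormalLiftOn (γ : ℝ → Q) (p : ∀ t : ℝ, TangentSpace (𝓡 n) (γ t) →L[ℝ] ℝ)
    (q₀ : Q) (U : Set Q) (X : Fin k → ∀ q : Q, S.D q) (c d : ℝ) : Prop :=
  ∃ (u : ℝ → Fin k → ℝ) (ξ : ℝ → EuclideanSpace ℝ (Fin n) →L[ℝ] ℝ),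
    Measurable u ∧ (∃ C : ℝ, ∀ t ∈ Icc c d, ‖u t‖ ≤ C) ∧
    IsACB ξ c d ∧
    (∀ t ∈ Icc c d, γ t ∈ U ∧
      p t = (ξ t).comp (mfderiv (𝓡 n) 𝓘(ℝ, EuclideanSpace ℝ (Fin n))
        (extChartAt (𝓡 n) q₀) (γ t))) ∧
    ∀ᵐ t ∂(volume.restrict (Icc c d)),
      velocity n γ t = S.controlVec X (γ t) (u t) ∧
      HasDerivAt ξ
        (-∑ i, u t i • (ξ t).comp (fderiv ℝ (coordField (n := n) q₀ (fun q => (X i q).1))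
          (extChartAt (𝓡 n) q₀ (γ t)))) t ∧
      ∀ w : Fin k → ℝ,
        p t (S.controlVec X (γ t) w) - (1 / 2) * ∑ i, w i ^ 2 ≤
          p t (S.controlVec X (γ t) (u t)) - (1 / 2) * ∑ i, u t i ^ 2

/-- A normal sub-Riemannian extremal on `[0, T]`: an admissible curve that carries a covector
field satisfying, in a chart and a local orthonormal frame around each time, the conditions of
the Pontryagin maximum principle with normal multiplier. (Given the maximum condition, the
adjoint equation does not depend on the chart and the orthonormal frame.) -/
def IsNormalExtremal (γ : ℝ → Q) (T : ℝ) : Prop :=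
  S.IsAdmissible γ 0 T ∧
    ∃ p : ∀ t : ℝ, TangentSpace (𝓡 n) (γ t) →L[ℝ] ℝ,
      ∀ t₀ ∈ Icc 0 T, ∃ (U : Set Q) (X : Fin k → ∀ q : Q, S.D q),
        S.IsOrthonormalFrame U X ∧ U ⊆ (extChartAt (𝓡 n) (γ t₀)).source ∧
        ∃ δ > 0, S.IsNormalLiftOn γ p (γ t₀) U X (max 0 (t₀ - δ)) (min T (t₀ + δ))

end SubRiemannianStructure

end

/-! In a chart let `x` be the extremal, `ξ` its covector, `X i` the frame, `H(z, p) = ½ ∑ p(X i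
z)²`. The maximum condition concerns a strictly concave quadratic function of the control, so it
forces `u i = ξ (X i x)`, and `(x, ξ)` solves Hamilton's equations for `H`.

Optimality comes from an explicit calibration, with no Hamilton-Jacobi equation to solve. For a
competitor `z` with control `w` and the same end-points, put `y = z - x` and `S = ξ(y) - (L + 1)(t -
a)‖y‖²`. When `S` is differentiated, the adjoint equation cancels the terms linear in `y`. What is
left is at most `L‖y‖²`, and the derivative `-(L + 1)` of the quadratic coefficient absorbs it with
`‖y‖²` to spare: `S' ≤ ½|w|² - ½|u|² - ‖y‖²` almost everywhere. Since `S` vanishes at both ends, the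
energy of `z` exceeds that of `x` by at least `∫ ‖y‖²`, which gives minimality and uniqueness
together (`calibration_integral`). The constant `L` is uniform as long as the quadratic coefficient
stays bounded, hence the restriction to short intervals.

This needs `z` to stay in the chart. Only competitors with at most the energy of the extremal
matter. That energy is `O(b - a)`, and it bounds coordinate displacement, so such curves remain in a
fixed ball (`IsAdmissible.mapsTo_ball`). A Lebesgue number of the resulting cover of `[0, T]` makes
the length uniform. -/

noncomputable section

open Filter Topology

/-! ### Uniform Taylor estimates -/

section Calculus

variable {E F : Type*} [NormedAddCommGroup E] [NormedSpace ℝ E] [NormedAddCommGroup F]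
  [NormedSpace ℝ F]

/-- Uniform bounds for a `C²` function and its first order Taylor remainder near a point. -/
theorem ContDiffAt.exists_taylor_bound {f : E → F} {x₀ : E} (hf : ContDiffAt ℝ 2 f x₀) :
    ∃ C : ℝ, 0 ≤ C ∧ ∀ᶠ p : E × E in 𝓝 (x₀, x₀), ‖f p.1‖ ≤ C ∧
      ‖f p.2 - f p.1‖ ≤ C * ‖p.2 - p.1‖ ∧
      ‖f p.2 - f p.1 - fderiv ℝ f p.1 (p.2 - p.1)‖ ≤ C * ‖p.2 - p.1‖ ^ 2 := by
  have hf1 : ContDiffAt ℝ 1 f x₀ := hf.of_le (by norm_num)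
  obtain ⟨K₁, s₁, hs₁, hK₁⟩ := hf1.exists_lipschitzOnWith
  obtain ⟨K₂, s₂, hs₂, hK₂⟩ :=
    (hf.fderiv_right (m := 1) (by norm_num)).exists_lipschitzOnWith
  have hd : ∀ᶠ x in 𝓝 x₀, DifferentiableAt ℝ f x := by
    filter_upwards [hf1.eventually (by simp)] with x hx using hx.differentiableAt (by simp)
  have hb : ∀ᶠ x in 𝓝 x₀, ‖f x‖ ≤ ‖f x₀‖ + 1 :=
    (hf.continuousAt.norm.eventually_lt continuousAt_const (lt_add_one _)).mono fun x hx => hx.le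
  obtain ⟨r, hr, hball⟩ := Metric.eventually_nhds_iff_ball.1 (((hd.and hb).and hs₁).and hs₂)
  refine ⟨‖f x₀‖ + 1 + K₁ + K₂, by positivity, ?_⟩
  filter_upwards [prod_mem_nhds (Metric.ball_mem_nhds x₀ hr) (Metric.ball_mem_nhds x₀ hr)]
  rintro ⟨x, z⟩ ⟨hx, hz⟩
  simp only at hx hz ⊢
  have h0 := norm_nonneg (f x₀)
  have h1 := K₁.coe_nonneg
  have h2 := K₂.coe_nonneg
  refine ⟨(hball x hx).1.1.2.trans (by linarith), ?_, ?_⟩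
  · have := hK₁.norm_sub_le (hball z hz).1.2 (hball x hx).1.2
    refine this.trans ?_
    gcongr
    linarith
  · have hs : Convex ℝ (Metric.ball x₀ r ∩ Metric.closedBall x ‖z - x‖) :=
      (convex_ball _ _).inter (convex_closedBall _ _)
    have := hs.norm_image_sub_le_of_norm_fderiv_le' (f := f) (φ := fderiv ℝ f x)
      (C := K₂ * ‖z - x‖) (fun w hw => (hball w hw.1).1.1.1) ?_
      (x := x) (y := z) ⟨hx, by simp⟩ ⟨hz, by simp [dist_eq_norm]⟩
    · refine this.trans ?_
      rw [mul_assoc, ← sq]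
      gcongr
      linarith
    · intro w hw
      refine (hK₂.norm_sub_le (hball w hw.1).2 (hball x hx).2).trans ?_
      gcongr
      simpa [dist_eq_norm] using hw.2

/-- Uniform bounds, on a ball, for a finite family of `C²` functions and their first order Taylor
remainders. -/
theorem exists_taylor_bound_ball {ι : Type*} [Finite ι] {f : ι → E → F} {x₀ : E}
    (hf : ∀ i, ContDiffAt ℝ 2 (f i) x₀) :
    ∃ C : ℝ, 0 ≤ C ∧ ∃ r > 0, ∀ x ∈ Metric.ball x₀ r, ∀ z ∈ Metric.ball x₀ r, ∀ i,
      ‖f i x‖ ≤ C ∧ ‖f i z - f i x‖ ≤ C * ‖z - x‖ ∧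
      ‖f i z - f i x - fderiv ℝ (f i) x (z - x)‖ ≤ C * ‖z - x‖ ^ 2 := by
  have := Fintype.ofFinite ι
  choose C hC h using fun i => (hf i).exists_taylor_bound
  obtain ⟨r, hr, hball⟩ := Metric.eventually_nhds_iff_ball.1 (eventually_all.2 h)
  refine ⟨∑ i, C i, Finset.sum_nonneg fun i _ => hC i, r, hr, fun x hx z hz i => ?_⟩
  have hi : C i ≤ ∑ i, C i := Finset.single_le_sum (fun i _ => hC i) (Finset.mem_univ i)
  obtain ⟨h1, h2, h3⟩ := hball (x, z) (by rw [← ball_prod_same]; exact ⟨hx, hz⟩) i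
  refine ⟨h1.trans hi, h2.trans ?_, h3.trans ?_⟩ <;> gcongr

end Calculus

/-! ### Absolutely continuous curves -/

section AbsolutelyContinuous

variable {E F : Type*} [NormedAddCommGroup E] [NormedSpace ℝ E] [NormedAddCommGroup F]

theorem AbsolutelyContinuousOnInterval.clm_comp [NormedSpace ℝ F] {x : ℝ → E} {a b : ℝ}
    (hx : AbsolutelyContinuousOnInterval x a b) (A : E →L[ℝ] F) :
    AbsolutelyContinuousOnInterval (fun t => A (x t)) a b := by
  refine squeeze_zero (fun t => Finset.sum_nonneg fun i _ => dist_nonneg) (fun t => ?_)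
    (by simpa using Tendsto.const_mul ‖A‖ hx)
  rw [Finset.mul_sum]
  gcongr
  simp only [dist_eq_norm, ← map_sub]
  exact A.le_opNorm _

theorem AbsolutelyContinuousOnInterval.finsetSum {ι : Type*} {f : ι → ℝ → F} {a b : ℝ}
    (s : Finset ι) (hf : ∀ i ∈ s, AbsolutelyContinuousOnInterval (f i) a b) :
    AbsolutelyContinuousOnInterval (fun t => ∑ i ∈ s, f i t) a b := by
  classical
  induction s using Finset.induction_on with
  | empty =>
    have : LipschitzOnWith 0 (fun _ : ℝ => (0 : F)) (uIcc a b) :=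
      (LipschitzWith.const _).lipschitzOnWith
    simpa using this.absolutelyContinuousOnInterval
  | insert i s hi ih =>
    simp only [Finset.sum_insert hi]
    exact (hf i (by simp)).fun_add (ih fun j hj => hf j (by simp [hj]))

variable {n : ℕ}

/-- Expanding `y` in the standard basis reduces the pairing to finitely many products of real
functions. -/
theorem AbsolutelyContinuousOnInterval.clm_apply
    {ξ : ℝ → EuclideanSpace ℝ (Fin n) →L[ℝ] ℝ} {y : ℝ → EuclideanSpace ℝ (Fin n)} {a b : ℝ}
    (hξ : AbsolutelyContinuousOnInterval ξ a b) (hy : AbsolutelyContinuousOnInterval y a b) :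
    AbsolutelyContinuousOnInterval (fun t => ξ t (y t)) a b := by
  have h : (fun t => ξ t (y t)) = fun t => ∑ i, y t i * ξ t (EuclideanSpace.single i 1) := by
    funext t
    conv_lhs => rw [← (EuclideanSpace.basisFun (Fin n) ℝ).sum_repr (y t)]
    simp
  rw [h]
  refine finsetSum _ fun i _ => ?_
  exact (hy.clm_comp (EuclideanSpace.proj i : _ →L[ℝ] ℝ)).fun_mul
    (hξ.clm_comp (ContinuousLinearMap.apply ℝ ℝ (EuclideanSpace.single i (1 : ℝ))))

theorem AbsolutelyContinuousOnInterval.norm_sq {y : ℝ → EuclideanSpace ℝ (Fin n)} {a b : ℝ}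
    (hy : AbsolutelyContinuousOnInterval y a b) :
    AbsolutelyContinuousOnInterval (fun t => ‖y t‖ ^ 2) a b := by
  have h : (fun t => ‖y t‖ ^ 2) = fun t => innerSL ℝ (y t) (y t) := by
    funext t
    exact (real_inner_self_eq_norm_sq _).symm
  rw [h]
  exact (hy.clm_comp (innerSL ℝ (E := EuclideanSpace ℝ (Fin n)))).clm_apply hy

/-- A fundamental theorem of calculus inequality for absolutely continuous functions. -/
theorem AbsolutelyContinuousOnInterval.sub_le_integral {f f' g : ℝ → ℝ} {a b : ℝ} (hab : a ≤ b)
    (hf : AbsolutelyContinuousOnInterval f a b)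
    (hd : ∀ᵐ t ∂volume.restrict (Icc a b), HasDerivAt f (f' t) t ∧ f' t ≤ g t)
    (hg : IntervalIntegrable g volume a b) :
    f b - f a ≤ ∫ t in a..b, g t := by
  rw [← hf.integral_deriv_eq_sub]
  refine intervalIntegral.integral_mono_ae_restrict hab hf.intervalIntegrable_deriv hg ?_
  filter_upwards [hd] with t ht
  rw [ht.1.deriv]
  exact ht.2

/-- The displacement of an absolutely continuous curve is at most the integral of a bound of its
speed. -/
theorem AbsolutelyContinuousOnInterval.norm_sub_le_integral {x x' : ℝ → EuclideanSpace ℝ (Fin n)}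
    {g : ℝ → ℝ} {a b : ℝ} (hab : a ≤ b) (hx : AbsolutelyContinuousOnInterval x a b)
    (hd : ∀ᵐ t ∂volume.restrict (Icc a b), HasDerivAt x (x' t) t ∧ ‖x' t‖ ≤ g t)
    (hg : IntervalIntegrable g volume a b) :
    ‖x b - x a‖ ≤ ∫ t in a..b, g t := by
  -- Pairing with the fixed total displacement reduces the vector inequality to the scalar one.
  set v := x b - x a with hv
  rcases eq_or_ne v 0 with h0 | h0
  · rw [h0, norm_zero]
    refine intervalIntegral.integral_nonneg_of_ae_restrict hab ?_
    filter_upwards [hd] with t ht using (norm_nonneg _).trans ht.2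
  have h := (hx.clm_comp (innerSL ℝ v)).sub_le_integral (g := fun t => ‖v‖ * g t)
    (f' := fun t => innerSL ℝ v (x' t)) hab ?_ (hg.const_mul _)
  · rw [intervalIntegral.integral_const_mul, ← map_sub, ← hv, innerSL_apply_apply,
      real_inner_self_eq_norm_mul_norm] at h
    exact le_of_mul_le_mul_left h (norm_pos_iff.2 h0)
  · filter_upwards [hd] with t ht
    refine ⟨(innerSL ℝ v).hasFDerivAt.comp_hasDerivAt t ht.1, ?_⟩
    exact (real_inner_le_norm v (x' t)).trans (by gcongr; exact ht.2)

end AbsolutelyContinuous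

/-! ### The calibration inequality -/

section Calibration

/-- The scalar estimate behind the calibration: here `u` and `β` are the pairings of a covector
with a vector field at two points, `d` is the derivative of the first in the direction of the
displacement, and `e₀`, `e` are corrections due to a change of the covector. -/
theorem calibration_scalar_bound {u β d e₀ e w A B m s : ℝ} (hu : |u| ≤ m) (hr : |β - u - d| ≤ A * s)
    (he : |e - e₀| ≤ A * s) (hδ : (β + e - u) ^ 2 ≤ B * s) :
    u * (-d) + (w * (β + e) - u * (u + e₀)) ≤
      (1 / 2) * w ^ 2 - (1 / 2) * u ^ 2 + (2 * m * A + B / 2) * s := by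
  have h1 : |u * (β - u - d + (e - e₀))| ≤ m * (A * s + A * s) := by
    rw [abs_mul]
    exact mul_le_mul hu ((abs_add_le _ _).trans (add_le_add hr he)) (abs_nonneg _)
      ((abs_nonneg u).trans hu)
  have h2 := (abs_le.1 h1).2
  -- Young's inequality gives `w(β + e) ≤ ½w² + ½(β + e)²`. Expanding the last square about `u`
  -- leaves `u(β - u - d + e - e₀) + ½(β + e - u)²` as the error.
  nlinarith [sq_nonneg (w - (β + e))]

variable {n k : ℕ}

local notation "E" => EuclideanSpace ℝ (Fin n)

/-- The pointwise calibration inequality. -/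
theorem calibration_pointwise {X : Fin k → E → E} {x z : E} {ξ : E →L[ℝ] ℝ} {C m α : ℝ}
    (hC : 0 ≤ C) (hm : ‖ξ‖ ≤ m) (hα : |α| ≤ 1)
    (hX : ∀ i, ‖X i x‖ ≤ C ∧ ‖X i z‖ ≤ C ∧ ‖X i z - X i x‖ ≤ C * ‖z - x‖ ∧
      ‖X i z - X i x - fderiv ℝ (X i) x (z - x)‖ ≤ C * ‖z - x‖ ^ 2) (w : Fin k → ℝ) :
    (-∑ i, ξ (X i x) • ξ.comp (fderiv ℝ (X i) x)) (z - x) +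
      ξ (∑ i, w i • X i z - ∑ i, ξ (X i x) • X i x) +
      α * inner ℝ (z - x) (∑ i, w i • X i z - ∑ i, ξ (X i x) • X i x) ≤
    (1 / 2) * ∑ i, w i ^ 2 - (1 / 2) * ∑ i, ξ (X i x) ^ 2 +
      k * (2 * (m * C) * ((m + 1) * C) + ((m + 1) * C) ^ 2 / 2) * ‖z - x‖ ^ 2 := by
  set y := z - x with hy
  have hm0 : 0 ≤ m := (norm_nonneg _).trans hm
  have key : ∀ i, ξ (X i x) * (-ξ (fderiv ℝ (X i) x y)) +
      (w i * (ξ (X i z) + α * inner ℝ y (X i z)) -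
        ξ (X i x) * (ξ (X i x) + α * inner ℝ y (X i x))) ≤
      (1 / 2) * w i ^ 2 - (1 / 2) * ξ (X i x) ^ 2 +
        (2 * (m * C) * ((m + 1) * C) + ((m + 1) * C) ^ 2 / 2) * ‖y‖ ^ 2 := by
    intro i
    obtain ⟨h1, h2, h3, h4⟩ := hX i
    -- Here `β = ξ (X i z)`, `d = ξ (DX i(x) y)` and the corrections are `α⟨y, X i x⟩`, `α⟨y, X i
    -- z⟩`; `|α| ≤ 1` keeps the constants free of `α`.
    apply calibration_scalar_bound
    · exact (ξ.le_opNorm _).trans (mul_le_mul hm h1 (norm_nonneg _) hm0)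
    · rw [← map_sub, ← map_sub]
      refine (ξ.le_opNorm _).trans ((mul_le_mul hm h4 (norm_nonneg _) hm0).trans ?_)
      nlinarith [mul_nonneg hC (sq_nonneg ‖y‖)]
    · rw [← mul_sub, ← inner_sub_right, abs_mul]
      have h5 : |inner ℝ y (X i z - X i x)| ≤ ‖y‖ * (C * ‖y‖) :=
        (abs_real_inner_le_norm _ _).trans (by gcongr)
      have h6 := mul_le_mul hα h5 (abs_nonneg _) zero_le_one
      refine h6.trans ?_
      nlinarith [mul_nonneg (mul_nonneg hm0 hC) (sq_nonneg ‖y‖)]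
    · have h5 : |inner ℝ y (X i z)| ≤ ‖y‖ * C :=
        (abs_real_inner_le_norm _ _).trans (by gcongr)
      have h6 : |α * inner ℝ y (X i z)| ≤ ‖y‖ * C := by
        rw [abs_mul]
        exact (mul_le_mul hα h5 (abs_nonneg _) zero_le_one).trans (one_mul _).le
      have h7 : |ξ (X i z - X i x)| ≤ m * (C * ‖y‖) :=
        (ξ.le_opNorm _).trans (mul_le_mul hm h3 (norm_nonneg _) hm0)
      have h8 : |ξ (X i z) + α * inner ℝ y (X i z) - ξ (X i x)| ≤ (m + 1) * C * ‖y‖ := by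
        have := (abs_add_le (ξ (X i z - X i x)) (α * inner ℝ y (X i z))).trans (add_le_add h7 h6)
        rw [map_sub] at this
        rw [show ξ (X i z) + α * inner ℝ y (X i z) - ξ (X i x) =
          ξ (X i z) - ξ (X i x) + α * inner ℝ y (X i z) by ring]
        linarith
      rw [← sq_abs, ← mul_pow]
      exact pow_le_pow_left₀ (abs_nonneg _) h8 2
  have := Finset.sum_le_sum fun i (_ : i ∈ Finset.univ) => key i
  refine (Eq.trans_le ?_ this).trans_eq ?_
  · simp only [Finset.sum_add_distrib, Finset.sum_sub_distrib, mul_add, map_sub, map_sum, map_smul,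
      smul_eq_mul, inner_sub_right, inner_sum, inner_smul_right, mul_sub, Finset.mul_sum,
      neg_apply, sum_apply, smul_apply,
      ContinuousLinearMap.comp_apply, mul_neg, Finset.sum_neg_distrib, mul_left_comm _ α]
    ring
  · simp only [Finset.sum_add_distrib, Finset.sum_sub_distrib, Finset.mul_sum, Finset.sum_const,
      Finset.card_univ, Fintype.card_fin, nsmul_eq_mul]
    ring

/-- The integrated calibration inequality: along a curve `x` with a normal covector `ξ`, the energy
of a nearby curve `z` with the same end-points exceeds that of `x` by the squared `L²` distance. -/
theorem calibration_integral {X : Fin k → E → E} {x z : ℝ → E} {ξ : ℝ → E →L[ℝ] ℝ}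
    {q₁ q₂ : ℝ → ℝ} {a b C m : ℝ} (hab : a ≤ b) (hC : 0 ≤ C)
    (hx : AbsolutelyContinuousOnInterval x a b) (hz : AbsolutelyContinuousOnInterval z a b)
    (hξ : AbsolutelyContinuousOnInterval ξ a b) (hm : ∀ t ∈ Icc a b, ‖ξ t‖ ≤ m)
    (hshort : 2 * (k * (2 * (m * C) * ((m + 1) * C) + ((m + 1) * C) ^ 2 / 2) + 1) * (b - a) ≤ 1)
    (hX : ∀ t ∈ Icc a b, ∀ i, ‖X i (x t)‖ ≤ C ∧ ‖X i (z t)‖ ≤ C ∧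
      ‖X i (z t) - X i (x t)‖ ≤ C * ‖z t - x t‖ ∧
      ‖X i (z t) - X i (x t) - fderiv ℝ (X i) (x t) (z t - x t)‖ ≤ C * ‖z t - x t‖ ^ 2)
    (hq₁ : IntervalIntegrable q₁ volume a b) (hq₂ : IntervalIntegrable q₂ volume a b)
    (h₁ : ∀ᵐ t ∂volume.restrict (Icc a b),
      HasDerivAt x (∑ i, ξ t (X i (x t)) • X i (x t)) t ∧ q₁ t = ∑ i, ξ t (X i (x t)) ^ 2 ∧
      HasDerivAt ξ (-∑ i, ξ t (X i (x t)) • (ξ t).comp (fderiv ℝ (X i) (x t))) t)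
    (h₂ : ∀ᵐ t ∂volume.restrict (Icc a b), ∃ w : Fin k → ℝ,
      HasDerivAt z (∑ i, w i • X i (z t)) t ∧ q₂ t = ∑ i, w i ^ 2)
    (ha : z a = x a) (hb : z b = x b) :
    ∫ t in a..b, ‖z t - x t‖ ^ 2 ≤ (1 / 2) * (∫ t in a..b, q₂ t) - (1 / 2) * ∫ t in a..b, q₁ t := by
  set L : ℝ := k * (2 * (m * C) * ((m + 1) * C) + ((m + 1) * C) ^ 2 / 2) with hL
  have hm0 : 0 ≤ m := (norm_nonneg _).trans (hm a (left_mem_Icc.2 hab))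
  have hL0 : 0 ≤ L := by positivity
  -- After the factor `½`, the slope contributes `-(L + 1)‖z - x‖²`: `L` pays for the pointwise
  -- error and `1` is the final gain. `hshort` is exactly `|α| ≤ 1`.
  set α : ℝ → ℝ := fun t => -(2 * (L + 1) * (t - a)) with hα
  have hα1 : ∀ t ∈ Icc a b, |α t| ≤ 1 := by
    intro t ht
    rw [hα, abs_neg, abs_of_nonneg (mul_nonneg (by positivity) (sub_nonneg.2 ht.1))]
    refine le_trans ?_ hshort
    have := ht.2
    gcongr
  have hy : AbsolutelyContinuousOnInterval (fun t => z t - x t) a b := hz.fun_sub hx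
  have hαd : ∀ t, HasDerivAt α (-(2 * (L + 1))) t := by
    intro t
    have := (((hasDerivAt_id t).sub_const a).const_mul (2 * (L + 1))).fun_neg
    rwa [mul_one] at this
  have hαac : AbsolutelyContinuousOnInterval α a b := by
    apply ContDiffOn.absolutelyContinuousOnInterval
    apply ContDiff.contDiffOn
    fun_prop
  have hf : AbsolutelyContinuousOnInterval
      (fun t => ξ t (z t - x t) + (1 / 2) * (α t * ‖z t - x t‖ ^ 2)) a b :=
    (hξ.clm_apply hy).fun_add ((hαac.fun_mul hy.norm_sq).const_mul _)
  have hint : IntervalIntegrable (fun t => ‖z t - x t‖ ^ 2) volume a b :=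
    hy.norm_sq.continuousOn.intervalIntegrable
  have hg : IntervalIntegrable (fun t => (1 / 2) * q₂ t - (1 / 2) * q₁ t - ‖z t - x t‖ ^ 2)
      volume a b := ((hq₂.const_mul _).sub (hq₁.const_mul _)).sub hint
  choose! w hw using fun t (h : ∃ w : Fin k → ℝ,
      HasDerivAt z (∑ i, w i • X i (z t)) t ∧ q₂ t = ∑ i, w i ^ 2) => h
  have := hf.sub_le_integral hab (f' := fun t =>
      ((-∑ i, ξ t (X i (x t)) • (ξ t).comp (fderiv ℝ (X i) (x t))) (z t - x t) +
        ξ t (∑ i, w t i • X i (z t) - ∑ i, ξ t (X i (x t)) • X i (x t))) +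
      (1 / 2) * (-(2 * (L + 1)) * ‖z t - x t‖ ^ 2 + α t *
        (2 * inner ℝ (z t - x t) (∑ i, w t i • X i (z t) - ∑ i, ξ t (X i (x t)) • X i (x t))))) ?_ hg
  · rw [intervalIntegral.integral_sub ((hq₂.const_mul _).sub (hq₁.const_mul _)) hint,
      intervalIntegral.integral_sub (hq₂.const_mul _) (hq₁.const_mul _),
      intervalIntegral.integral_const_mul, intervalIntegral.integral_const_mul] at this
    simp only [ha, hb, sub_self, map_zero, norm_zero] at this
    linarith
  · filter_upwards [h₁, h₂, ae_restrict_mem measurableSet_Icc] with t ht₁ ht₂ ht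
    obtain ⟨hxd, hq, hξd⟩ := ht₁
    obtain ⟨hzd, hq'⟩ := hw t ht₂
    refine ⟨(hξd.clm_apply (hzd.sub hxd)).add
      ((HasDerivAt.mul (hαd t) (hzd.sub hxd).norm_sq).const_mul _), ?_⟩
    have := calibration_pointwise hC (hm t ht) (hα1 t ht) (hX t ht) (w t)
    rw [hq, hq']
    rw [← hL] at this
    linarith

end Calibration

/-! ### Vector fields and velocities in a chart -/

section Chart

variable {n : ℕ} {Q : Type*} [TopologicalSpace Q] [ChartedSpace (EuclideanSpace ℝ (Fin n)) Q]

theorem coordField_extChartAt {q₀ q : Q} (X : ∀ q : Q, TangentSpace (𝓡 n) q)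
    (hq : q ∈ (extChartAt (𝓡 n) q₀).source) :
    coordField q₀ X (extChartAt (𝓡 n) q₀ q) =
      mfderiv (𝓡 n) 𝓘(ℝ, EuclideanSpace ℝ (Fin n)) (extChartAt (𝓡 n) q₀) q (X q) := by
  unfold coordField
  rw [(extChartAt (𝓡 n) q₀).left_inv hq]

theorem IsACB.mono {E : Type*} [NormedAddCommGroup E] [NormedSpace ℝ E] {x : ℝ → E}
    {a b c d : ℝ} (hx : IsACB x a b) (hac : a ≤ c) (hcd : c ≤ d) (hdb : d ≤ b) : IsACB x c d := by
  have hs : Icc c d ⊆ Icc a b := Icc_subset_Icc hac hdb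
  refine ⟨hx.1.mono ?_, hx.2.imp fun C hC => ae_restrict_of_ae_restrict_of_subset hs hC⟩
  rwa [uIcc_of_le hcd, uIcc_of_le (hac.trans (hcd.trans hdb))]

theorem IsACBCurve.mono {γ : ℝ → Q} {a b c d : ℝ} (hγ : IsACBCurve n γ a b) (hac : a ≤ c)
    (hdb : d ≤ b) : IsACBCurve n γ c d :=
  ⟨hγ.1.mono (Icc_subset_Icc hac hdb), fun q₀ c' d' h₁ h₂ h₃ h₄ =>
    hγ.2 q₀ c' d' (hac.trans h₁) h₂ (h₃.trans hdb) h₄⟩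

variable [IsManifold (𝓡 n) ∞ Q]

/-- The differential of the chart is the tangent bundle trivialization at `q₀`, so near the point
`coordField` is the trivialized section composed with the inverse chart. -/
theorem IsSmoothSection.contDiffAt_coordField {D : ∀ q : Q, Submodule ℝ (TangentSpace (𝓡 n) q)}
    {X : ∀ q : Q, D q} {U : Set Q} (hX : IsSmoothSection D X U) (hU : IsOpen U) {q₀ q : Q}
    (hqU : q ∈ U) (hq : q ∈ (extChartAt (𝓡 n) q₀).source) :
    ContDiffAt ℝ ∞ (coordField q₀ fun q => (X q).1) (extChartAt (𝓡 n) q₀ q) := by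
  have h1 : ContMDiffAt (𝓡 n) (𝓡 n).tangent ∞
      (fun q => (⟨q, (X q : TangentSpace (𝓡 n) q)⟩ : TangentBundle (𝓡 n) Q)) q :=
    (hX q hqU).contMDiffAt (hU.mem_nhds hqU)
  have hq' : q ∈ (chartAt (EuclideanSpace ℝ (Fin n)) q₀).source := by simpa using hq
  have h2 := ((trivializationAt (EuclideanSpace ℝ (Fin n)) (TangentSpace (𝓡 n))
    q₀).contMDiffAt_section_iff (n := ∞) (IB := 𝓡 n)
    (s := fun q => (X q : TangentSpace (𝓡 n) q)) (x₀ := q) (by simpa using hq')).1 h1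
  have h3 : ContMDiffAt 𝓘(ℝ, EuclideanSpace ℝ (Fin n)) (𝓡 n) ∞ (extChartAt (𝓡 n) q₀).symm
      (extChartAt (𝓡 n) q₀ q) :=
    (contMDiffOn_extChartAt_symm q₀ _ ((extChartAt (𝓡 n) q₀).map_source hq)).contMDiffAt
      ((isOpen_extChartAt_target q₀).mem_nhds ((extChartAt (𝓡 n) q₀).map_source hq))
  have h4 := ContMDiffAt.comp_of_eq (x := extChartAt (𝓡 n) q₀ q) h2 h3
    ((extChartAt (𝓡 n) q₀).left_inv hq)
  refine h4.contDiffAt.congr_of_eventuallyEq ?_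
  filter_upwards [(isOpen_extChartAt_target q₀).mem_nhds ((extChartAt (𝓡 n) q₀).map_source hq)]
    with x hx
  have hx' : (extChartAt (𝓡 n) q₀).symm x ∈ (chartAt (EuclideanSpace ℝ (Fin n)) q₀).source := by
    simpa using (extChartAt (𝓡 n) q₀).map_target hx
  have h5 := DFunLike.congr_fun (TangentBundle.continuousLinearMapAt_trivializationAt (I := 𝓡 n) hx')
    (X ((extChartAt (𝓡 n) q₀).symm x)).1
  refine Eq.trans h5.symm ?_
  refine (congrFun (Bundle.Trivialization.continuousLinearMapAt_apply _ _ _) _).trans ?_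
  rw [Bundle.Trivialization.coe_linearMapAt_of_mem _ (by simpa using hx')]
  rfl

theorem mfderiv_extChartAt_injective {q₀ q : Q} (hq : q ∈ (extChartAt (𝓡 n) q₀).source) :
    Function.Injective
      (mfderiv (𝓡 n) 𝓘(ℝ, EuclideanSpace ℝ (Fin n)) (extChartAt (𝓡 n) q₀) q) := by
  have : IsManifold (𝓡 n) 1 Q := .of_le (n := ∞) (by simp)
  exact (isInvertible_mfderiv_extChartAt hq).injective

/-- Composing with the inverse chart makes `γ` itself differentiable at `t`, so `velocity` is not
the default value of `mfderiv` and the chain rule applies. -/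
theorem hasDerivAt_extChartAt_comp {γ : ℝ → Q} {q₀ : Q} {t : ℝ} (hγ : ContinuousAt γ t)
    (ht : γ t ∈ (extChartAt (𝓡 n) q₀).source)
    (hd : DifferentiableAt ℝ (fun s => extChartAt (𝓡 n) q₀ (γ s)) t) :
    HasDerivAt (fun s => extChartAt (𝓡 n) q₀ (γ s))
      (mfderiv (𝓡 n) 𝓘(ℝ, EuclideanSpace ℝ (Fin n)) (extChartAt (𝓡 n) q₀) (γ t)
        (velocity n γ t)) t := by
  have : IsManifold (𝓡 n) 1 Q := .of_le (n := ∞) (by simp)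
  have h3 : MDifferentiableAt 𝓘(ℝ, EuclideanSpace ℝ (Fin n)) (𝓡 n) (extChartAt (𝓡 n) q₀).symm
      (extChartAt (𝓡 n) q₀ (γ t)) :=
    ((contMDiffOn_extChartAt_symm (n := 1) q₀ _
      ((extChartAt (𝓡 n) q₀).map_source ht)).contMDiffAt
      ((isOpen_extChartAt_target q₀).mem_nhds
        ((extChartAt (𝓡 n) q₀).map_source ht))).mdifferentiableAt (by simp)
  have h4 : MDifferentiableAt 𝓘(ℝ, ℝ) (𝓡 n) γ t := by
    have h5 : MDifferentiableAt 𝓘(ℝ, ℝ) (𝓡 n)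
        ((extChartAt (𝓡 n) q₀).symm ∘ fun s => extChartAt (𝓡 n) q₀ (γ s)) t :=
      MDifferentiableAt.comp t h3 hd.mdifferentiableAt
    refine h5.congr_of_eventuallyEq ?_
    filter_upwards [hγ ((isOpen_extChartAt_source q₀).mem_nhds ht)] with s hs
    exact ((extChartAt (𝓡 n) q₀).left_inv hs).symm
  have h6 : MDifferentiableAt (𝓡 n) 𝓘(ℝ, EuclideanSpace ℝ (Fin n)) (extChartAt (𝓡 n) q₀) (γ t) :=
    mdifferentiableAt_extChartAt (by simpa using ht)
  have h7 := mfderiv_comp t h6 h4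
  rw [mfderiv_eq_fderiv] at h7
  exact hd.hasFDerivAt.hasDerivAt.congr_deriv (DFunLike.congr_fun h7 (1 : ℝ))

theorem IsACBCurve.ae_hasDerivAt {γ : ℝ → Q} {q₀ : Q} {a b : ℝ} (hab : a ≤ b)
    (hγ : IsACBCurve n γ a b) (hs : MapsTo γ (Icc a b) (extChartAt (𝓡 n) q₀).source) :
    ∀ᵐ t ∂volume.restrict (Icc a b), HasDerivAt (fun s => extChartAt (𝓡 n) q₀ (γ s))
      (mfderiv (𝓡 n) 𝓘(ℝ, EuclideanSpace ℝ (Fin n)) (extChartAt (𝓡 n) q₀) (γ t)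
        (velocity n γ t)) t := by
  have hx := (hγ.2 q₀ a b le_rfl hab le_rfl hs).1
  have h₁ : ∀ᵐ x : ℝ, x ≠ a := by simp [ae_iff, measure_singleton]
  have h₂ : ∀ᵐ x : ℝ, x ≠ b := by simp [ae_iff, measure_singleton]
  have h₃ := hx.boundedVariationOn.ae_differentiableAt_of_mem_uIcc
  rw [ae_restrict_iff' measurableSet_Icc]
  filter_upwards [h₁, h₂, h₃] with t hta htb htd ht
  rw [uIcc_of_le hab] at htd
  have htI : Icc a b ∈ 𝓝 t :=
    Icc_mem_nhds (lt_of_le_of_ne ht.1 (Ne.symm hta)) (lt_of_le_of_ne ht.2 htb)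
  exact hasDerivAt_extChartAt_comp (hγ.1.continuousAt htI) (hs ht) (htd ht)

end Chart

/-! ### The metric in a frame -/

namespace SubRiemannianStructure

variable {n k : ℕ} {Q : Type*} [TopologicalSpace Q] [ChartedSpace (EuclideanSpace ℝ (Fin n)) Q]
  [IsManifold (𝓡 n) ∞ Q] (S : SubRiemannianStructure n k Q)

theorem quad_nonneg (q : Q) (v : TangentSpace (𝓡 n) q) : 0 ≤ S.quad q v := by
  unfold quad
  split_ifs with h
  · rcases eq_or_ne (⟨v, h⟩ : S.D q) 0 with h0 | h0
    · simp [h0]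
    · exact (S.g_pos q _ h0).le
  · exact le_rfl

theorem controlVec_eq_coe (X : Fin k → ∀ q : Q, S.D q) (q : Q) (w : Fin k → ℝ) :
    S.controlVec X q w = (∑ i, w i • X i q : S.D q) := by
  simp [controlVec]

theorem quad_controlVec (X : Fin k → ∀ q : Q, S.D q) (q : Q) (w : Fin k → ℝ) :
    S.quad q (S.controlVec X q w) = ∑ i, ∑ j, w i * (w j * S.g q (X i q) (X j q)) := by
  have h : ∀ v : S.D q, S.quad q v = S.g q v v := fun v => by simp [quad]
  rw [controlVec_eq_coe, h]
  simp only [map_sum, map_smul, LinearMap.sum_apply, LinearMap.smul_apply, smul_eq_mul,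
    Finset.mul_sum]
  refine Finset.sum_congr rfl fun i _ => Finset.sum_congr rfl fun j _ => ?_
  rw [S.g_symm q (X i q)]

theorem exists_controlVec {X : Fin k → ∀ q : Q, S.D q} {q : Q}
    (hX : Submodule.span ℝ (range fun i => X i q) = ⊤) {v : TangentSpace (𝓡 n) q}
    (hv : v ∈ S.D q) : ∃ w : Fin k → ℝ, v = S.controlVec X q w := by
  have : (⟨v, hv⟩ : S.D q) ∈ Submodule.span ℝ (range fun i => X i q) := hX ▸ Submodule.mem_top
  obtain ⟨w, hw⟩ := (Submodule.mem_span_range_iff_exists_fun ℝ).1 this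
  exact ⟨w, by rw [controlVec_eq_coe, hw]⟩

theorem IsOrthonormalFrame.quad_controlVec {S : SubRiemannianStructure n k Q} {U : Set Q}
    {X : Fin k → ∀ q : Q, S.D q} (hX : S.IsOrthonormalFrame U X) {q : Q} (hq : q ∈ U)
    (w : Fin k → ℝ) : S.quad q (S.controlVec X q w) = ∑ i, w i ^ 2 := by
  rw [S.quad_controlVec]
  simp [(hX.2.2 q hq).1, sq]

theorem mfderiv_controlVec {X : Fin k → ∀ q : Q, S.D q} {q₀ q : Q}
    (hq : q ∈ (extChartAt (𝓡 n) q₀).source) (w : Fin k → ℝ) :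
    mfderiv (𝓡 n) 𝓘(ℝ, EuclideanSpace ℝ (Fin n)) (extChartAt (𝓡 n) q₀) q
      (S.controlVec X q w) =
      ∑ i, w i • coordField q₀ (fun q => (X i q).1) (extChartAt (𝓡 n) q₀ q) := by
  simp only [coordField_extChartAt _ hq, controlVec, map_sum, map_smul]
  rfl

variable {S}

theorem IsAdmissible.mono {γ : ℝ → Q} {a b c d : ℝ} (hγ : S.IsAdmissible γ a b) (hac : a ≤ c)
    (hdb : d ≤ b) : S.IsAdmissible γ c d :=
  ⟨hγ.1.mono hac hdb, ae_restrict_of_ae_restrict_of_subset (Icc_subset_Icc hac hdb) hγ.2⟩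

end SubRiemannianStructure

/-! ### Integrability of the energy density -/

section EssentiallyBounded

theorem ContinuousOn.memLp_top_Icc {f : ℝ → ℝ} {a b : ℝ} (hf : ContinuousOn f (Icc a b)) :
    MemLp f ⊤ (volume.restrict (Icc a b)) := by
  obtain ⟨C, hC⟩ := isCompact_Icc.exists_bound_of_continuousOn hf
  refine memLp_top_of_bound (hf.aestronglyMeasurable measurableSet_Icc) C ?_
  filter_upwards [ae_restrict_mem measurableSet_Icc] with t ht using hC t ht

variable {E : Type*} [NormedAddCommGroup E] [InnerProductSpace ℝ E]

theorem IsACB.memLp_top_inner_deriv [CompleteSpace E] [SecondCountableTopology E] {x Y : ℝ → E}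
    {a b : ℝ} (hx : IsACB x a b) (hY : ContinuousOn Y (Icc a b)) :
    MemLp (fun t => inner ℝ (Y t) (deriv x t)) ⊤ (volume.restrict (Icc a b)) := by
  borelize E
  obtain ⟨C, hC⟩ := isCompact_Icc.exists_bound_of_continuousOn hY
  obtain ⟨D, hD⟩ := hx.2
  refine memLp_top_of_bound ((hY.aestronglyMeasurable measurableSet_Icc).inner
    (measurable_deriv x).aestronglyMeasurable) (C * D) ?_
  filter_upwards [ae_restrict_mem measurableSet_Icc, hD] with t ht htD
  exact (norm_inner_le_norm _ _).trans
    (mul_le_mul (hC t ht) htD (norm_nonneg _) ((norm_nonneg _).trans (hC t ht)))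

/-- The coefficients of a vector of the span of a linearly independent family are recovered by the
inverse of the Gram matrix. -/
theorem gram_inv_mulVec_inner {ι : Type*} [Fintype ι] [DecidableEq ι] {Y : ι → E}
    (hY : LinearIndependent ℝ Y) (w : ι → ℝ) :
    Matrix.mulVec (Matrix.gram ℝ Y)⁻¹ (fun i => inner ℝ (Y i) (∑ j, w j • Y j)) = w := by
  have h : (fun i => inner ℝ (Y i) (∑ j, w j • Y j)) = Matrix.mulVec (Matrix.gram ℝ Y) w := by
    funext i
    simp [Matrix.mulVec, dotProduct, inner_sum, inner_smul_right, Matrix.gram, mul_comm]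
  have hdet : IsUnit (Matrix.gram ℝ Y).det :=
    (Matrix.posDef_gram_of_linearIndependent hY).det_pos.ne'.isUnit
  rw [h, Matrix.mulVec_mulVec, Matrix.nonsing_inv_mul _ hdet, Matrix.one_mulVec]

theorem ContinuousOn.gram_inv {ι : Type*} [Fintype ι] [DecidableEq ι] {Y : ι → ℝ → E} {s : Set ℝ}
    (hY : ∀ i, ContinuousOn (Y i) s) (hli : ∀ t ∈ s, LinearIndependent ℝ fun i => Y i t) (i j : ι) :
    ContinuousOn (fun t => (Matrix.gram ℝ fun i => Y i t)⁻¹ i j) s := by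
  have hG : ContinuousOn (fun t => Matrix.gram ℝ fun i => Y i t) s :=
    continuousOn_pi.2 fun i => continuousOn_pi.2 fun j => (hY i).inner (hY j)
  have hdet : ContinuousOn (fun t => (Matrix.gram ℝ fun i => Y i t).det) s :=
    (Continuous.matrix_det continuous_id).comp_continuousOn hG
  have hadj : ContinuousOn (fun t => (Matrix.gram ℝ fun i => Y i t).adjugate i j) s :=
    ((Continuous.matrix_adjugate continuous_id).matrix_elem i j).comp_continuousOn hG
  have h := (hdet.inv₀ fun t ht =>
    (Matrix.posDef_gram_of_linearIndependent (hli t ht)).det_pos.ne').mul hadj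
  refine h.congr fun t _ => ?_
  simp [Matrix.inv_def]

end EssentiallyBounded

namespace SubRiemannianStructure

variable {n k : ℕ} {Q : Type*} [TopologicalSpace Q] [ChartedSpace (EuclideanSpace ℝ (Fin n)) Q]
  [IsManifold (𝓡 n) ∞ Q] {S : SubRiemannianStructure n k Q}

theorem linearIndependent_coordField {X : Fin k → ∀ q : Q, S.D q} {q₀ q : Q}
    (hq : q ∈ (extChartAt (𝓡 n) q₀).source) (hX : LinearIndependent ℝ fun i => X i q) :
    LinearIndependent ℝ
      fun i => coordField q₀ (fun q => (X i q).1) (extChartAt (𝓡 n) q₀ q) := by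
  rw [Fintype.linearIndependent_iff] at hX ⊢
  intro w hw
  rw [← S.mfderiv_controlVec hq] at hw
  have h0 := mfderiv_extChartAt_injective hq (hw.trans (map_zero _).symm)
  rw [controlVec_eq_coe] at h0
  exact hX w (Subtype.ext h0)

theorem continuousOn_coordField {X : ∀ q : Q, S.D q} {U : Set Q} (hU : IsOpen U)
    (hX : IsSmoothSection S.D X U) {q₀ : Q} {γ : ℝ → Q} {s : Set ℝ} (hγ : ContinuousOn γ s)
    (hs : MapsTo γ s (U ∩ (extChartAt (𝓡 n) q₀).source)) :
    ContinuousOn (fun t => coordField q₀ (fun q => (X q).1) (extChartAt (𝓡 n) q₀ (γ t))) s := by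
  intro t ht
  have h1 : ContinuousWithinAt (fun t => extChartAt (𝓡 n) q₀ (γ t)) s t :=
    ((continuousOn_extChartAt q₀).comp hγ fun t ht => (hs ht).2) t ht
  have h2 := (hX.contDiffAt_coordField hU (hs ht).1 (hs ht).2).continuousAt
  exact ContinuousAt.comp_continuousWithinAt (f := fun t => extChartAt (𝓡 n) q₀ (γ t)) h2 h1

/-- The inverse Gram matrix of the frame is continuous along the curve and recovers the control from
the essentially bounded coordinate velocity. The density is then quadratic in a bounded control,
with continuous coefficients. -/
theorem IsAdmissible.integrableOn_quad_of_mapsTo {γ : ℝ → Q} {c d : ℝ} (hcd : c ≤ d)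
    (hγ : S.IsAdmissible γ c d) {q₀ : Q} {U : Set Q} (hU : IsOpen U) {X : Fin k → ∀ q : Q, S.D q}
    (hX : ∀ i, IsSmoothSection S.D (X i) U)
    (hX' : ∀ q ∈ U, LinearIndependent ℝ (fun i => X i q) ∧
      Submodule.span ℝ (range fun i => X i q) = ⊤)
    (hs : MapsTo γ (Icc c d) (U ∩ (extChartAt (𝓡 n) q₀).source)) :
    IntegrableOn (fun t => S.quad (γ t) (velocity n γ t)) (Icc c d) := by
  set x : ℝ → EuclideanSpace ℝ (Fin n) := fun t => extChartAt (𝓡 n) q₀ (γ t) with hx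
  set Y : Fin k → ℝ → EuclideanSpace ℝ (Fin n) :=
    fun i t => coordField q₀ (fun q => (X i q).1) (x t) with hY
  have hsrc : MapsTo γ (Icc c d) (extChartAt (𝓡 n) q₀).source := fun t ht => (hs ht).2
  have hacb : IsACB x c d := hγ.1.2 q₀ c d le_rfl hcd le_rfl hsrc
  have hYc : ∀ i, ContinuousOn (Y i) (Icc c d) := fun i =>
    continuousOn_coordField hU (hX i) hγ.1.1 hs
  have hYli : ∀ t ∈ Icc c d, LinearIndependent ℝ fun i => Y i t := fun t ht =>
    linearIndependent_coordField (hs ht).2 (hX' _ (hs ht).1).1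
  set W : Fin k → ℝ → ℝ := fun i t =>
    Matrix.mulVec (Matrix.gram ℝ fun i => Y i t)⁻¹ (fun i => inner ℝ (Y i t) (deriv x t)) i with hW
  have hWmem : ∀ i, MemLp (W i) ⊤ (volume.restrict (Icc c d)) := by
    intro i
    refine memLp_finsetSum (f := fun j t => (Matrix.gram ℝ fun i => Y i t)⁻¹ i j *
      inner ℝ (Y j t) (deriv x t)) Finset.univ fun j _ => ?_
    exact (hacb.memLp_top_inner_deriv (hYc j)).mul
      (ContinuousOn.gram_inv hYc hYli i j).memLp_top_Icc
  have hg : ∀ i j, MemLp (fun t => S.g (γ t) (X i (γ t)) (X j (γ t))) ⊤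
      (volume.restrict (Icc c d)) := fun i j =>
    ((S.g_smooth U (X i) (X j) hU (hX i) (hX j)).continuousOn.comp hγ.1.1
      fun t ht => (hs ht).1).memLp_top_Icc
  have hWg : ∀ i j, MemLp (fun t => W j t * S.g (γ t) (X i (γ t)) (X j (γ t))) ⊤
      (volume.restrict (Icc c d)) := fun i j => (hg i j).mul (hWmem j)
  have hWWg : ∀ i j, MemLp (fun t => W i t * (W j t * S.g (γ t) (X i (γ t)) (X j (γ t)))) ⊤
      (volume.restrict (Icc c d)) := fun i j => (hWg i j).mul (hWmem i)
  have hsum : MemLp (fun t => ∑ i, ∑ j, W i t * (W j t * S.g (γ t) (X i (γ t)) (X j (γ t)))) ⊤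
      (volume.restrict (Icc c d)) :=
    memLp_finsetSum _ fun i _ => memLp_finsetSum _ fun j _ => hWWg i j
  refine (hsum.integrable le_top).congr ?_
  filter_upwards [hγ.2, hγ.1.ae_hasDerivAt hcd hsrc, ae_restrict_mem measurableSet_Icc]
    with t ht htd htI
  obtain ⟨w, hw⟩ := S.exists_controlVec (hX' _ (hs htI).1).2 ht
  rw [hw, S.mfderiv_controlVec (hs htI).2] at htd
  have hWw : ∀ i, W i t = w i := by
    intro i
    rw [hW]
    simp only
    rw [htd.deriv]
    exact congrFun (gram_inv_mulVec_inner (hYli t htI) w) i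
  simp only [hWw]
  rw [hw, quad_controlVec]

/-- A Bochner integral is `0` for a non-integrable function, so without this `energy` could be
spuriously small. Local frames and compactness of `[a, b]` suffice. -/
theorem IsAdmissible.integrableOn_quad {γ : ℝ → Q} {a b : ℝ} (hγ : S.IsAdmissible γ a b) :
    IntegrableOn (fun t => S.quad (γ t) (velocity n γ t)) (Icc a b) := by
  refine LocallyIntegrableOn.integrableOn_isCompact (fun t ht => ?_) isCompact_Icc
  obtain ⟨U, hU, htU, X, hX, hX'⟩ := S.exists_frame (γ t)
  have hnhds : U ∩ (extChartAt (𝓡 n) (γ t)).source ∈ 𝓝 (γ t) :=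
    inter_mem (hU.mem_nhds htU) (extChartAt_source_mem_nhds _)
  obtain ⟨δ, hδ, hball⟩ := Metric.mem_nhdsWithin_iff.1 (hγ.1.1 t ht hnhds)
  have hc : max a (t - δ / 2) ≤ min b (t + δ / 2) :=
    le_min (max_le (ht.1.trans ht.2) (by linarith [ht.2]))
      (max_le (by linarith [ht.1]) (by linarith))
  refine ⟨Icc (max a (t - δ / 2)) (min b (t + δ / 2)), ?_,
    (hγ.mono (le_max_left _ _) (min_le_left _ _)).integrableOn_quad_of_mapsTo hc hU hX hX'
      (q₀ := γ t) fun s hs => hball ⟨?_, ?_⟩⟩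
  · rw [← Icc_inter_Icc]
    exact inter_mem self_mem_nhdsWithin
      (mem_nhdsWithin_of_mem_nhds (Icc_mem_nhds (by linarith) (by linarith)))
  · rw [Metric.mem_ball, Real.dist_eq, abs_lt]
    have h1 := (le_max_right _ _).trans hs.1
    have h2 := hs.2.trans (min_le_right _ _)
    constructor <;> linarith
  · exact ⟨(le_max_left _ _).trans hs.1, hs.2.trans (min_le_left _ _)⟩

theorem IsAdmissible.intervalIntegrable_quad {γ : ℝ → Q} {a b : ℝ} (hab : a ≤ b)
    (hγ : S.IsAdmissible γ a b) :
    IntervalIntegrable (fun t => S.quad (γ t) (velocity n γ t)) volume a b :=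
  (intervalIntegrable_iff_integrableOn_Icc_of_le hab).2 hγ.integrableOn_quad

end SubRiemannianStructure

/-- The maximizer of a quadratic Hamiltonian. -/
theorem eq_of_isMax_hamiltonian {ι : Type*} [Fintype ι] {c u : ι → ℝ}
    (h : ∀ w : ι → ℝ, ∑ i, w i * c i - (1 / 2) * ∑ i, w i ^ 2 ≤
      ∑ i, u i * c i - (1 / 2) * ∑ i, u i ^ 2) : u = c := by
  have h1 : ∑ i, (u i - c i) ^ 2 ≤ 0 := by
    have h2 := h c
    have h3 : ∑ i, (u i - c i) ^ 2 =
        ∑ i, u i ^ 2 - 2 * ∑ i, u i * c i + ∑ i, c i ^ 2 := by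
      rw [Finset.mul_sum, ← Finset.sum_sub_distrib, ← Finset.sum_add_distrib]
      exact Finset.sum_congr rfl fun i _ => by ring
    have h4 : ∑ i, c i * c i = ∑ i, c i ^ 2 := Finset.sum_congr rfl fun i _ => by ring
    linarith
  have h5 := (Finset.sum_eq_zero_iff_of_nonneg fun i _ => sq_nonneg _).1
    (h1.antisymm (Finset.sum_nonneg fun i _ => sq_nonneg (u i - c i)))
  funext i
  have := h5 i (Finset.mem_univ i)
  exact sub_eq_zero.1 (pow_eq_zero_iff two_ne_zero |>.1 this)

/-! ### Controls, displacement and Hamilton's equations -/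

namespace SubRiemannianStructure

variable {n k : ℕ} {Q : Type*} [TopologicalSpace Q] [ChartedSpace (EuclideanSpace ℝ (Fin n)) Q]
  [IsManifold (𝓡 n) ∞ Q] {S : SubRiemannianStructure n k Q}

/-- An admissible curve in the domain of an orthonormal frame is driven, in coordinates, by a
control whose squared norm is the value of the metric on the velocity. -/
theorem IsAdmissible.ae_exists_control {η : ℝ → Q} {a b : ℝ} (hab : a ≤ b)
    (hη : S.IsAdmissible η a b) {q₀ : Q} {U : Set Q} {X : Fin k → ∀ q : Q, S.D q}
    (hX : S.IsOrthonormalFrame U X)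
    (hs : MapsTo η (Icc a b) (U ∩ (extChartAt (𝓡 n) q₀).source)) :
    ∀ᵐ t ∂volume.restrict (Icc a b), ∃ w : Fin k → ℝ,
      HasDerivAt (fun t => extChartAt (𝓡 n) q₀ (η t))
        (∑ i, w i • coordField q₀ (fun q => (X i q).1) (extChartAt (𝓡 n) q₀ (η t))) t ∧
      S.quad (η t) (velocity n η t) = ∑ i, w i ^ 2 := by
  filter_upwards [hη.2, hη.1.ae_hasDerivAt hab fun t ht => (hs ht).2,
    ae_restrict_mem measurableSet_Icc] with t ht htd htI
  obtain ⟨w, hw⟩ := S.exists_controlVec (hX.2.2 _ (hs htI).1).2 ht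
  rw [hw, S.mfderiv_controlVec (hs htI).2] at htd
  exact ⟨w, htd, by rw [hw, hX.quad_controlVec (hs htI).1]⟩

/-- The coordinate displacement of an admissible curve is controlled by its energy. -/
theorem IsAdmissible.norm_sub_le {η : ℝ → Q} {a b C : ℝ} (hab : a ≤ b)
    (hη : S.IsAdmissible η a b) {q₀ : Q} {U : Set Q} {X : Fin k → ∀ q : Q, S.D q}
    (hX : S.IsOrthonormalFrame U X)
    (hs : MapsTo η (Icc a b) (U ∩ (extChartAt (𝓡 n) q₀).source))
    (hC : ∀ t ∈ Icc a b, ∀ i,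
      ‖coordField q₀ (fun q => (X i q).1) (extChartAt (𝓡 n) q₀ (η t))‖ ≤ C) :
    ‖extChartAt (𝓡 n) q₀ (η b) - extChartAt (𝓡 n) q₀ (η a)‖ ≤
      ∫ t in a..b, C / 2 * (k + S.quad (η t) (velocity n η t)) := by
  have hac : AbsolutelyContinuousOnInterval (fun t => extChartAt (𝓡 n) q₀ (η t)) a b :=
    (hη.1.2 q₀ a b le_rfl hab le_rfl fun t ht => (hs ht).2).1
  have hg : IntervalIntegrable (fun t => C / 2 * (k + S.quad (η t) (velocity n η t))) volume a b :=
    (intervalIntegrable_const.add (hη.intervalIntegrable_quad hab)).const_mul (C / 2)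
  suffices hd : ∀ᵐ t ∂volume.restrict (Icc a b), HasDerivAt (fun t => extChartAt (𝓡 n) q₀ (η t))
      (deriv (fun t => extChartAt (𝓡 n) q₀ (η t)) t) t ∧
      ‖deriv (fun t => extChartAt (𝓡 n) q₀ (η t)) t‖ ≤
        C / 2 * (k + S.quad (η t) (velocity n η t))  by
    have h := hac.norm_sub_le_integral hab hd hg
    exact h
  filter_upwards [hη.ae_exists_control hab hX hs, ae_restrict_mem measurableSet_Icc] with t hw ht
  obtain ⟨w, hw, hq⟩ := hw
  refine ⟨hw.differentiableAt.hasDerivAt, ?_⟩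
  rw [hw.deriv, hq]
  have hi : ∀ i, ‖w i • coordField q₀ (fun q => (X i q).1) (extChartAt (𝓡 n) q₀ (η t))‖ ≤
      C / 2 * (1 + w i ^ 2) := by
    intro i
    have hC0 := (norm_nonneg _).trans (hC t ht i)
    -- `2|w| ≤ 1 + w²` trades speed for energy without a square root.
    have h1 : |w i| * C ≤ C / 2 * (1 + w i ^ 2) := by
      rw [← sq_abs (w i)]
      nlinarith [mul_nonneg hC0 (sq_nonneg (|w i| - 1))]
    rw [norm_smul, Real.norm_eq_abs]
    exact (mul_le_mul_of_nonneg_left (hC t ht i) (abs_nonneg _)).trans h1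
  refine (norm_sum_le_of_le Finset.univ fun i _ => hi i).trans_eq ?_
  rw [← Finset.mul_sum, Finset.sum_add_distrib]
  simp

/-- The maximum principle in coordinates: the control is the pairing of the covector with the
frame, so the curve and the covector solve Hamilton's equations. -/
theorem IsNormalLiftOn.exists_covector {γ : ℝ → Q} {p : ∀ t : ℝ, TangentSpace (𝓡 n) (γ t) →L[ℝ] ℝ}
    {q₀ : Q} {U : Set Q} {X : Fin k → ∀ q : Q, S.D q} {c d : ℝ} (hcd : c ≤ d)
    (hγ : S.IsAdmissible γ c d) (hX : S.IsOrthonormalFrame U X)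
    (hU : U ⊆ (extChartAt (𝓡 n) q₀).source) (h : S.IsNormalLiftOn γ p q₀ U X c d) :
    (∀ t ∈ Icc c d, γ t ∈ U) ∧ ∃ ξ : ℝ → EuclideanSpace ℝ (Fin n) →L[ℝ] ℝ, IsACB ξ c d ∧
      ∀ᵐ t ∂volume.restrict (Icc c d),
        HasDerivAt (fun t => extChartAt (𝓡 n) q₀ (γ t))
          (∑ i, ξ t (coordField q₀ (fun q => (X i q).1) (extChartAt (𝓡 n) q₀ (γ t))) •
            coordField q₀ (fun q => (X i q).1) (extChartAt (𝓡 n) q₀ (γ t))) t ∧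
        S.quad (γ t) (velocity n γ t) =
          ∑ i, ξ t (coordField q₀ (fun q => (X i q).1) (extChartAt (𝓡 n) q₀ (γ t))) ^ 2 ∧
        HasDerivAt ξ
          (-∑ i, ξ t (coordField q₀ (fun q => (X i q).1) (extChartAt (𝓡 n) q₀ (γ t))) •
            (ξ t).comp (fderiv ℝ (coordField q₀ fun q => (X i q).1)
              (extChartAt (𝓡 n) q₀ (γ t)))) t := by
  obtain ⟨u, ξ, -, -, hξ, hp, hae⟩ := h
  refine ⟨fun t ht => (hp t ht).1, ξ, hξ, ?_⟩
  filter_upwards [hae, hγ.1.ae_hasDerivAt hcd fun t ht => hU (hp t ht).1,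
    ae_restrict_mem measurableSet_Icc] with t ⟨hv, hξd, hmax⟩ htd ht
  obtain ⟨hγU, hpt⟩ := hp t ht
  have hpw : ∀ w : Fin k → ℝ, p t (S.controlVec X (γ t) w) =
      ∑ i, w i * ξ t (coordField q₀ (fun q => (X i q).1) (extChartAt (𝓡 n) q₀ (γ t))) := by
    intro w
    rw [hpt]
    refine (congrArg (ξ t) (S.mfderiv_controlVec (hU hγU) w)).trans ?_
    simp
  have hu : u t = fun i =>
      ξ t (coordField q₀ (fun q => (X i q).1) (extChartAt (𝓡 n) q₀ (γ t))) :=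
    eq_of_isMax_hamiltonian fun w => by simpa only [hpw] using hmax w
  rw [hv, S.mfderiv_controlVec (hU hγU)] at htd
  rw [hv, hX.quad_controlVec hγU]
  rw [hu] at htd hξd ⊢
  exact ⟨htd, rfl, hξd⟩

end SubRiemannianStructure

/-! ### Confinement and local optimality -/

namespace SubRiemannianStructure

variable {n k : ℕ} {Q : Type*} [TopologicalSpace Q] [ChartedSpace (EuclideanSpace ℝ (Fin n)) Q]
  [IsManifold (𝓡 n) ∞ Q] {S : SubRiemannianStructure n k Q}

/-- An admissible curve of small energy that starts near the centre of a coordinate ball stays in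
that ball. -/
theorem IsAdmissible.mapsTo_ball [T2Space Q] {η : ℝ → Q} {a b C R : ℝ} (hab : a ≤ b)
    (hη : S.IsAdmissible η a b) {q₀ : Q} {U : Set Q} {X : Fin k → ∀ q : Q, S.D q}
    (hX : S.IsOrthonormalFrame U X) {x₀ : EuclideanSpace ℝ (Fin n)}
    (hR : Metric.closedBall x₀ R ⊆
      (extChartAt (𝓡 n) q₀).target ∩ (extChartAt (𝓡 n) q₀).symm ⁻¹' U)
    (hC0 : 0 ≤ C)
    (hC : ∀ x ∈ Metric.closedBall x₀ R, ∀ i, ‖coordField q₀ (fun q => (X i q).1) x‖ ≤ C)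
    (ha : η a ∈ (extChartAt (𝓡 n) q₀).source)
    (ha' : extChartAt (𝓡 n) q₀ (η a) ∈ Metric.ball x₀ (R / 2))
    (hE : ∫ t in a..b, C / 2 * (k + S.quad (η t) (velocity n η t)) < R / 2) :
    ∀ t ∈ Icc a b, η t ∈ U ∩ (extChartAt (𝓡 n) q₀).source ∧
      extChartAt (𝓡 n) q₀ (η t) ∈ Metric.closedBall x₀ R := by
  set φ := extChartAt (𝓡 n) q₀ with hφ
  set K : Set Q := φ.symm '' Metric.closedBall x₀ R with hK
  have hKmem : ∀ q ∈ K, q ∈ U ∩ φ.source ∧ φ q ∈ Metric.closedBall x₀ R := by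
    rintro _ ⟨x, hx, rfl⟩
    exact ⟨⟨(hR hx).2, φ.map_target (hR hx).1⟩, by rwa [φ.right_inv (hR hx).1]⟩
  -- Compact sets are closed because `Q` is Hausdorff; otherwise a curve could reach a limit outside
  -- the chart.
  have hKclosed : IsClosed K :=
    ((isCompact_closedBall x₀ R).image_of_continuousOn
      ((continuousOn_extChartAt_symm q₀).mono fun x hx => (hR hx).1)).isClosed
  have hVK : φ.source ∩ φ ⁻¹' Metric.ball x₀ R ⊆ K := fun q hq =>
    ⟨φ q, Metric.ball_subset_closedBall hq.2, φ.left_inv hq.1⟩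
  have hVopen : IsOpen (φ.source ∩ φ ⁻¹' Metric.ball x₀ R) :=
    isOpen_extChartAt_preimage' q₀ Metric.isOpen_ball
  have hR0 : 0 < R / 2 := Metric.pos_of_mem_ball ha'
  have hg : IntervalIntegrable (fun t => C / 2 * (k + S.quad (η t) (velocity n η t))) volume a b :=
    (intervalIntegrable_const.add (hη.intervalIntegrable_quad hab)).const_mul (C / 2)
  suffices h : Icc a b ⊆ η ⁻¹' K from fun t ht => hKmem _ (h ht)
  have hcl : IsClosed (η ⁻¹' K ∩ Icc a b) := by
    rw [inter_comm]
    exact hη.1.1.preimage_isClosed_of_isClosed isClosed_Icc hKclosed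
  -- Continuous induction: if the curve lies in `K` up to `t`, its displacement is below `R / 2`, so
  -- it is in the open ball at `t` and stays in `K` a little longer.
  refine hcl.Icc_subset_of_forall_mem_nhdsGT_of_Icc_subset
    (hVK ⟨ha, Metric.ball_subset_ball (by linarith) ha'⟩) fun t ht hsub => ?_
  have hd := (hη.mono le_rfl ht.2.le).norm_sub_le ht.1 hX (q₀ := q₀)
    (fun s hs => (hKmem _ (hsub hs)).1) (fun s hs => hC _ (hKmem _ (hsub hs)).2)
  have hle : ∫ s in a..t, C / 2 * (k + S.quad (η s) (velocity n η s)) ≤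
      ∫ s in a..b, C / 2 * (k + S.quad (η s) (velocity n η s)) := by
    refine intervalIntegral.integral_mono_interval le_rfl ht.1 ht.2.le
      (Eventually.of_forall fun s => ?_) hg
    have := S.quad_nonneg (η s) (velocity n η s)
    simp only [Pi.zero_apply]
    positivity
  have hV : η t ∈ φ.source ∩ φ ⁻¹' Metric.ball x₀ R := by
    refine ⟨(hKmem _ (hsub ⟨ht.1, le_rfl⟩)).1.2, ?_⟩
    rw [mem_preimage, Metric.mem_ball]
    refine (dist_triangle _ (φ (η a)) _).trans_lt ?_
    rw [Metric.mem_ball] at ha'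
    rw [dist_eq_norm (φ (η t))]
    linarith
  have hcont : ContinuousWithinAt η (Ioi t) t :=
    (hη.1.1 t ⟨ht.1, ht.2.le⟩).mono_of_mem_nhdsWithin (Icc_mem_nhdsGT_of_mem ht)
  exact mem_of_superset (hcont (hVopen.mem_nhds hV)) fun s hs => hVK hs

/-- Local optimality of a normal extremal near one of its times, among admissible curves of at
most the same energy. -/
theorem IsNormalLiftOn.exists_eqOn_of_energy_le [T2Space Q] {γ : ℝ → Q} {T t₀ δ : ℝ}
    {p : ∀ t : ℝ, TangentSpace (𝓡 n) (γ t) →L[ℝ] ℝ} {U : Set Q} {X : Fin k → ∀ q : Q, S.D q}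
    (hγ : S.IsAdmissible γ 0 T) (ht₀ : t₀ ∈ Icc 0 T) (hX : S.IsOrthonormalFrame U X)
    (hU : U ⊆ (extChartAt (𝓡 n) (γ t₀)).source) (hδ : 0 < δ)
    (h : S.IsNormalLiftOn γ p (γ t₀) U X (max 0 (t₀ - δ)) (min T (t₀ + δ))) :
    ∃ ρ > 0, ∀ a b : ℝ, 0 ≤ a → a ≤ b → b ≤ T → a ∈ Metric.ball t₀ ρ → b ∈ Metric.ball t₀ ρ →
      ∀ η : ℝ → Q, S.IsAdmissible η a b → η a = γ a → η b = γ b →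
        S.energy η a b ≤ S.energy γ a b →
        EqOn η γ (Icc a b) ∧ S.energy γ a b ≤ S.energy η a b := by
  set c := max 0 (t₀ - δ) with hc
  set d := min T (t₀ + δ) with hd
  have hct : c ≤ t₀ := max_le ht₀.1 (by linarith)
  have htd : t₀ ≤ d := le_min ht₀.2 (by linarith)
  obtain ⟨hγU, ξ, hξ, hae⟩ := h.exists_covector (hct.trans htd)
    (hγ.mono (le_max_left _ _) (min_le_left _ _)) hX hU
  set φ := extChartAt (𝓡 n) (γ t₀) with hφ
  set f : Fin k → EuclideanSpace ℝ (Fin n) → EuclideanSpace ℝ (Fin n) :=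
    fun i => coordField (γ t₀) (fun q => (X i q).1) with hf
  set x₀ := φ (γ t₀) with hx₀
  have hγt₀ : γ t₀ ∈ U := hγU t₀ ⟨hct, htd⟩
  obtain ⟨C, hC0, r, hr, htaylor⟩ := exists_taylor_bound_ball (x₀ := x₀) (f := f) fun i =>
    ((hX.2.1 i).contDiffAt_coordField hX.1 hγt₀ (hU hγt₀)).of_le ENat.LEInfty.out
  have hnhds : φ.target ∩ φ.symm ⁻¹' U ∈ 𝓝 x₀ := by
    refine inter_mem ((isOpen_extChartAt_target _).mem_nhds (φ.map_source (hU hγt₀))) ?_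
    refine (continuousAt_extChartAt_symm (γ t₀)).preimage_mem_nhds ?_
    rw [extChartAt_to_inv]
    exact hX.1.mem_nhds hγt₀
  obtain ⟨r', hr', hball⟩ := Metric.mem_nhds_iff.1 hnhds
  obtain ⟨R, hR, hRr, hRr'⟩ : ∃ R > 0, R < r ∧ R < r' :=
    ⟨min r r' / 2, by positivity, by linarith [min_le_left r r', lt_min hr hr'],
      by linarith [min_le_right r r', lt_min hr hr']⟩
  have hRU : Metric.closedBall x₀ R ⊆ φ.target ∩ φ.symm ⁻¹' U :=
    (Metric.closedBall_subset_ball hRr').trans hball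
  have hRr : Metric.closedBall x₀ R ⊆ Metric.ball x₀ r := Metric.closedBall_subset_ball hRr
  obtain ⟨m, hm⟩ := hξ.1.exists_bound
  rw [uIcc_of_le (hct.trans htd)] at hm
  have hm0 : 0 ≤ m := (norm_nonneg _).trans (hm t₀ ⟨hct, htd⟩)
  have hγnhds : γ ⁻¹' (φ.source ∩ φ ⁻¹' Metric.ball x₀ (R / 2)) ∈ 𝓝[Icc 0 T] t₀ := by
    refine (hγ.1.1 t₀ ht₀).preimage_mem_nhdsWithin ?_
    exact (isOpen_extChartAt_preimage' (γ t₀) Metric.isOpen_ball).mem_nhds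
      ⟨hU hγt₀, Metric.mem_ball_self (by positivity)⟩
  obtain ⟨ρ₁, hρ₁, hγball⟩ := Metric.mem_nhdsWithin_iff.1 hγnhds
  set L : ℝ := k * (2 * (m * C) * ((m + 1) * C) + ((m + 1) * C) ^ 2 / 2) + 1 with hL
  -- `N * (b - a)` bounds the displacement of any competitor with at most the energy of `γ`.
  set N : ℝ := C / 2 * (k + k * (m * C) ^ 2) with hN
  have hL0 : 0 < L := by positivity
  have hN0 : 0 ≤ N := by positivity
  -- Since `b - a < 2ρ`, the four bounds keep `[a, b]` in the domain of the lift, keep `γ` in the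
  -- half ball, ensure `2L(b - a) ≤ 1`, and ensure `N(b - a) < R / 2`.
  refine ⟨min (min δ ρ₁) (min (1 / (4 * L)) (R / (4 * (N + 1)))), by positivity, ?_⟩
  intro a b ha hab hb haρ hbρ η hη hηa hηb hE
  simp only [Metric.mem_ball, lt_min_iff, Real.dist_eq, abs_lt] at haρ hbρ
  obtain ⟨⟨haδ, haρ₁⟩, haL, haN⟩ := haρ
  obtain ⟨⟨hbδ, hbρ₁⟩, hbL, hbN⟩ := hbρ
  have hba : 0 ≤ b - a := sub_nonneg.2 hab
  have hca : c ≤ a := max_le ha (by linarith [haδ.1])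
  have hbd : b ≤ d := le_min hb (by linarith [hbδ.2])
  have hshort : 2 * L * (b - a) ≤ 1 := by
    have h1 : b - a ≤ 2 * (1 / (4 * L)) := by linarith [haL.1, hbL.2]
    have h2 := mul_le_mul_of_nonneg_left h1 (by positivity : 0 ≤ 2 * L)
    refine h2.trans_eq ?_
    field_simp
    norm_num
  have hspeed : N * (b - a) < R / 2 := by
    have h1 : b - a ≤ 2 * (R / (4 * (N + 1))) := by linarith [haN.1, hbN.2]
    have h2 : N * (b - a) ≤ N * (2 * (R / (4 * (N + 1)))) := by gcongr
    have h3 : (N + 1) * (2 * (R / (4 * (N + 1)))) = R / 2 := by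
      field_simp
      norm_num
    have h4 : 0 < R / (4 * (N + 1)) := by positivity
    linarith
  have hγV : ∀ t ∈ Icc a b, γ t ∈ φ.source ∧ φ (γ t) ∈ Metric.ball x₀ (R / 2) := by
    intro t ht
    refine hγball ⟨?_, ha.trans ht.1, ht.2.trans hb⟩
    rw [Metric.mem_ball, Real.dist_eq, abs_lt]
    constructor <;> linarith [ht.1, ht.2, haρ₁.1, hbρ₁.2]
  have hγK : ∀ t ∈ Icc a b, φ (γ t) ∈ Metric.closedBall x₀ R := fun t ht =>
    Metric.ball_subset_closedBall (Metric.ball_subset_ball (by linarith) (hγV t ht).2)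
  have hsub : Icc a b ⊆ Icc c d := Icc_subset_Icc hca hbd
  have hae' := ae_restrict_of_ae_restrict_of_subset hsub hae
  have hγab : S.IsAdmissible γ a b := hγ.mono ha hb
  have hqγ := hγab.intervalIntegrable_quad hab
  have hqη := hη.intervalIntegrable_quad hab
  have hEγ : ∫ t in a..b, S.quad (γ t) (velocity n γ t) ≤ k * (m * C) ^ 2 * (b - a) := by
    have h1 : ∫ t in a..b, S.quad (γ t) (velocity n γ t) ≤ ∫ _ in a..b, k * (m * C) ^ 2 := by
      refine intervalIntegral.integral_mono_ae_restrict hab hqγ intervalIntegrable_const ?_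
      filter_upwards [hae', ae_restrict_mem measurableSet_Icc] with t hq ht
      rw [hq.2.1]
      have h2 : ∀ i ∈ Finset.univ, ξ t (f i (φ (γ t))) ^ 2 ≤ (m * C) ^ 2 := by
        intro i _
        rw [← sq_abs]
        refine pow_le_pow_left₀ (abs_nonneg _) ?_ 2
        refine ((ξ t).le_opNorm _).trans (mul_le_mul (hm t (hsub ht)) ?_ (norm_nonneg _) hm0)
        exact (htaylor _ (hRr (hγK t ht)) _ (hRr (hγK t ht)) i).1
      refine (Finset.sum_le_sum h2).trans_eq ?_
      simp
    refine h1.trans_eq ?_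
    rw [intervalIntegral.integral_const, smul_eq_mul, mul_comm]
  have hint : ∫ t in a..b, S.quad (η t) (velocity n η t) ≤
      ∫ t in a..b, S.quad (γ t) (velocity n γ t) := by
    unfold energy at hE
    linarith
  have hstay := hη.mapsTo_ball hab hX (x₀ := x₀) (R := R) (q₀ := γ t₀) hRU hC0
    (fun x hx i => (htaylor x (hRr hx) x (hRr hx) i).1)
    (hηa ▸ (hγV a (left_mem_Icc.2 hab)).1) (hηa ▸ (hγV a (left_mem_Icc.2 hab)).2) (by
      rw [intervalIntegral.integral_const_mul, intervalIntegral.integral_add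
        intervalIntegrable_const hqη, intervalIntegral.integral_const, smul_eq_mul]
      refine lt_of_le_of_lt ?_ hspeed
      rw [hN, mul_assoc]
      gcongr
      linarith)
  have hx : AbsolutelyContinuousOnInterval (fun t => φ (γ t)) a b :=
    (hγab.1.2 (γ t₀) a b le_rfl hab le_rfl fun t ht => (hγV t ht).1).1
  have hz : AbsolutelyContinuousOnInterval (fun t => φ (η t)) a b :=
    (hη.1.2 (γ t₀) a b le_rfl hab le_rfl fun t ht => (hstay t ht).1.2).1
  have key := calibration_integral (X := f) hab hC0 hx hz (hξ.mono hca hab hbd).1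
    (fun t ht => hm t (hsub ht)) hshort
    (fun t ht i => by
      have h1 := htaylor _ (hRr (hγK t ht)) _ (hRr (hstay t ht).2) i
      exact ⟨h1.1, (htaylor _ (hRr (hstay t ht).2) _ (hRr (hstay t ht).2) i).1, h1.2⟩)
    hqγ hqη hae' (hη.ae_exists_control hab hX fun t ht => (hstay t ht).1)
    (by rw [hηa]) (by rw [hηb])
  have hnonneg : 0 ≤ ∫ t in a..b, ‖φ (η t) - φ (γ t)‖ ^ 2 :=
    intervalIntegral.integral_nonneg hab fun t _ => sq_nonneg _
  refine ⟨?_, by unfold energy; linarith⟩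
  rcases hab.eq_or_lt with rfl | hlt
  · intro t ht
    rw [Icc_self, mem_singleton_iff] at ht
    rw [ht, hηa]
  intro t ht
  refine φ.injOn (hstay t ht).1.2 (hγV t ht).1 ?_
  by_contra hne
  have hcont : ContinuousOn (fun t => ‖φ (η t) - φ (γ t)‖ ^ 2) (Icc a b) := by
    have h1 := (hz.fun_sub hx).continuousOn
    rw [uIcc_of_le hab] at h1
    exact h1.norm.pow 2
  -- By continuity one point of disagreement makes the integral positive, while `key` and `hint`
  -- make it at most `0`.
  have hpos := intervalIntegral.integral_pos hlt hcont (fun t _ => sq_nonneg _)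
    ⟨t, ht, by have := sub_ne_zero.2 hne; positivity⟩
  linarith

end SubRiemannianStructure

end

/-! ### From local to uniform optimality -/

theorem theorem2 {n k : ℕ} {Q : Type*} [TopologicalSpace Q] [T2Space Q]
    [ChartedSpace (EuclideanSpace ℝ (Fin n)) Q] [IsManifold (𝓡 n) ∞ Q]
    (S : SubRiemannianStructure n k Q) {T : ℝ} (hT : 0 < T) {γ : ℝ → Q}
    (hγ : S.IsNormalExtremal γ T) :
    ∃ ε > 0, ∀ a b : ℝ, 0 ≤ a → a ≤ b → b ≤ T → b - a < ε →
      S.IsMinimizingGeodesic γ a b ∧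
        ∀ η : ℝ → Q, S.IsMinimizingGeodesic η a b → η a = γ a → η b = γ b →
          EqOn η γ (Icc a b) := by
  obtain ⟨hadm, p, hp⟩ := hγ
  have hloc : ∀ t₀ : Icc 0 T, ∃ ρ > 0, ∀ a b : ℝ, 0 ≤ a → a ≤ b → b ≤ T →
      a ∈ Metric.ball t₀.1 ρ → b ∈ Metric.ball t₀.1 ρ →
      ∀ η : ℝ → Q, S.IsAdmissible η a b → η a = γ a → η b = γ b →
        S.energy η a b ≤ S.energy γ a b →
        EqOn η γ (Icc a b) ∧ S.energy γ a b ≤ S.energy η a b := by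
    rintro ⟨t₀, ht₀⟩
    obtain ⟨U, X, hX, hU, δ, hδ, hlift⟩ := hp t₀ ht₀
    exact hlift.exists_eqOn_of_energy_le hadm ht₀ hX hU hδ
  choose ρ hρ hloc using hloc
  obtain ⟨ε, hε, hball⟩ := lebesgue_number_lemma_of_metric (isCompact_Icc (a := (0 : ℝ)) (b := T))
    (c := fun t₀ : Icc 0 T => Metric.ball t₀.1 (ρ t₀)) (fun _ => Metric.isOpen_ball)
    fun t ht => mem_iUnion.2 ⟨⟨t, ht⟩, Metric.mem_ball_self (hρ _)⟩
  refine ⟨ε, hε, fun a b ha hab hb hlt => ?_⟩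
  obtain ⟨t₀, ht₀⟩ := hball a ⟨ha, hab.trans hb⟩
  have hloc' := hloc t₀ a b ha hab hb (ht₀ (Metric.mem_ball_self hε))
    (ht₀ (by rwa [Metric.mem_ball, Real.dist_eq, abs_of_nonneg (sub_nonneg.2 hab)]))
  have hγab : S.IsAdmissible γ a b := hadm.mono ha hb
  refine ⟨⟨hγab, fun η hη hηa hηb => ?_⟩, fun η hη hηa hηb => ?_⟩
  · rcases le_total (S.energy γ a b) (S.energy η a b) with h | h
    · exact h
    · exact (hloc' η hη hηa hηb h).2
  · exact (hloc' η hη.1 hηa hηb (hη.2 γ hγab hηa.symm hηb.symm)).1
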